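/- **Setting.** Let $d\in\{1,2,3\}$, let $\mathcal D\subset\mathbb R^d$ be a nonempty bounded convex polyhedral domain, $T>0$, $I=[0,T)$, and let $(u,v)=\int_{\mathcal D}\overline u\,v\,dx$ be the inner product of $L^2(\mathcal D)=L^2(\mathcal D,\mathbb C)$. Let $\beta\ge 0$, $\Omega\in\mathbb R$, and let $V\in L^\infty(\mathcal D,\mathbb R)$ satisfy, for some $\lambda>0$ and almost all $\mathbf x\in\mathcal D$, $V(\mathbf x)\ge 0$ and $V(\mathbf x)-\frac{1+\lambda}{4}\Omega^2(x^2+y^2)\ge 0$ (the rotational term $\Omega^2(x^2+y^2)$ is dropped if $d=1$). Put $b=0$ if $d=1$, $b(\mathbf x)=\Omega(y,-x)$ if $d=2$, $b(\mathbf x)=\Omega(y,-x,0)$ if $d=3$, and $$(u,v)_{\mathcal H}=\int_{\mathcal D}\sum_{i=1}^d\overline{\big(\partial_i u-\tfrac{\mathrm i}{2}b_iu\big)}\,\big(\partial_i v-\tfrac{\mathrm i}{2}b_iv\big)+\big(V-\tfrac14|b|^2\big)\overline u\,v\;dx .$$ *Space discretization.* For every $h>0$ let $S_h\subset H^1_0(\mathcal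 D)$ be a finite dimensional subspace and let $P_h:H^1_0(\mathcal D)\to S_h$ be the Ritz projection, $(v-P_hv,w)_{\mathcal H}=0$ for all $w\in S_h$. Assume: * there are an integer $r\ge1$ and $C,h_0>0$ such that for $k=0,1$, all $0<h\le h_0$, all integers $2\le s\le r+1$ and all $v\in H^s(\mathcal D)\cap H^1_0(\mathcal D)$: $\|v-P_hv\|_{H^k(\mathcal D)}\le Ch^{s-k}|v|_{H^s(\mathcal D)}$; * there are $C,h_0>0$ such that for all $0<h\le h_0$ and $v_h\in S_h$: $\|v_h\|_{L^\infty(\mathcal D)}\le Ch^{-d/2}\|v_h\|_{L^2(\mathcal D)}$; * there are $C_\infty,h_0>0$ such that for all $0<h\le h_0$ and $v\in H^2(\mathcal D)\cap H^1_0(\mathcal D)$: $\|v-P_hv\|_{L^\infty(\mathcal D)}\le C_\infty|v|_{H^2(\mathcal D)}$. *Time discretization.* Fix $\rho_0>0$ and an integer $q\ge1$. A partition $0=t_0<t_1<\dots<t_N=T$ with $I_n=(t_n,t_{n+1}]$, $\tau_n=t_{n+1}-t_n$, $\tau=\max_n\tau_n$ is admissible if $\rho_0\tau\le\min_n\tau_n$.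 For $p\ge 0$ let $V_p$ be the space of functions $v$ on $\mathcal D\times(0,T]$ with $v(\mathbf x,t)=\sum_{j=0}^p t^j\varphi_{nj}(\mathbf x)$ for $t\in I_n$, with $\varphi_{nj}\in S_h$, $n=0,\dots,N-1$. *Scheme.* Let $u_0\in H^1_0(\mathcal D)$. A solution of the fully discrete scheme (for given $h$ and admissible partition) is a function $u\in V_q$ such that for all $n=0,\dots,N-1$ $$\int_{I_n}(\mathrm i\,\partial_tu,v)-(u,v)_{\mathcal H}-\beta(|u|^2u,v)\,dt=0\qquad\forall v\in V_{q-1},$$ $\lim_{t\searrow t_n}u(t)=u(t_n)$ for $n=1,\dots,N-1$, and $\lim_{t\searrow 0}u(t)=P_hu_0$. **Lemma (uniqueness).** (1) For every $M_0>0$ there is $\tau_0>0$ such that, for every $h>0$ and every admissible partition with $\tau<\tau_0$: if $u_1,u_2\in V_q$ are solutions of the fully discrete scheme with $\|u_i\|_{L^\infty(I\times\mathcal D)}\le M_0$, $i=1,2$, then $u_1=u_2$ on $(0,T]$. (2) Consequently, a uniformly bounded family of discrete solutions is unique: for every $M>0$ there is $\tau_0>0$ such that for all $\tau_1,h_1>0$,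 any two families of solutions of the fully discrete scheme, indexed by $0<h<h_1$ and the admissible partitions with $\tau<\tau_1$ and whose members all satisfy $\|u\|_{L^\infty(I\times\mathcal D)}<M$, coincide for all $0<h<h_1$ and all admissible partitions with $\tau<\min(\tau_0,\tau_1)$. -/

import Mathlib

open MeasureTheory Set Filter Topology
open scoped ComplexConjugate ENNReal ContDiff

noncomputable section

namespace GPE

/-- The Euclidean space `ℝ^d`. -/
abbrev Space (d : ℕ) : Type := EuclideanSpace ℝ (Fin d)

/-- The complex Lebesgue space `L²(D)`. Its Mathlib inner product is
`(u, v) = ∫_D conj (u x) * v x dx`, conjugate-linear in the first argument. -/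
abbrev L2 {d : ℕ} (D : Set (Space d)) : Type := Lp ℂ 2 (volume.restrict D)

/-! ### Domains -/

/-- A nonempty bounded open convex polyhedral domain: a finite intersection of open half spaces
which is nonempty and bounded. -/
structure IsConvexPolyhedralDomain {d : ℕ} (D : Set (Space d)) : Prop where
  isOpen : IsOpen D
  nonempty : D.Nonempty
  convex : Convex ℝ D
  bounded : Bornology.IsBounded D
  polyhedral : ∃ (m : ℕ) (a : Fin m → Space d) (c : Fin m → ℝ),
    D = {x | ∀ i, inner ℝ (a i) x < c i}

/-! ### Weak derivatives and Sobolev spaces -/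

/-- Test functions `φ ∈ C_c^∞(D, ℂ)`. -/
structure IsTestFunction {d : ℕ} (D : Set (Space d)) (φ : Space d → ℂ) : Prop where
  smooth : ContDiff ℝ ∞ φ
  compact : HasCompactSupport φ
  support : tsupport φ ⊆ D

/-- The classical partial derivative `∂_i φ`. -/
def partialDeriv {d : ℕ} (i : Fin d) (φ : Space d → ℂ) : Space d → ℂ :=
  fun x => fderiv ℝ φ x (EuclideanSpace.single i 1)

/-- The classical derivative `∂^α φ` for a multi-index `α` (for smooth `φ` the order in which the
partial derivatives are taken is immaterial). -/
def multiDeriv {d : ℕ} (α : Fin d → ℕ) (φ : Space d → ℂ) : Space d → ℂ :=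
  (List.finRange d).foldr (fun i f => (partialDeriv i)^[α i] f) φ

/-- `g = D^α u` in the weak sense on `D`. -/
def HasWeakDeriv {d : ℕ} (D : Set (Space d)) (α : Fin d → ℕ) (u g : L2 D) : Prop :=
  ∀ φ : Space d → ℂ, IsTestFunction D φ →
    ∫ x in D, u x * multiDeriv α φ x = (-1) ^ (∑ i, α i) * ∫ x in D, g x * φ x

/-- `v ∈ H^s(D)`: all weak derivatives of order at most `s` exist in `L²(D)`. -/
def MemSobolev {d : ℕ} (D : Set (Space d)) (s : ℕ) (v : L2 D) : Prop :=
  ∀ α : Fin d → ℕ, ∑ i, α i ≤ s → ∃ g, HasWeakDeriv D α v g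

open Classical in
/-- The weak derivative `D^α v` (unique when it exists; `0` if it does not exist). -/
def weakDeriv {d : ℕ} (D : Set (Space d)) (α : Fin d → ℕ) (v : L2 D) : L2 D :=
  if h : ∃ g, HasWeakDeriv D α v g then h.choose else 0

/-- The seminorm `|v|_{H^s(D)}`, over all multi-indices of order exactly `s`. -/
def sobolevSeminorm {d : ℕ} (D : Set (Space d)) (s : ℕ) (v : L2 D) : ℝ :=
  √(∑ α ∈ Finset.piAntidiag (Finset.univ : Finset (Fin d)) s, ‖weakDeriv D α v‖ ^ 2)

/-- The norm `‖v‖_{H^k(D)}`, over all multi-indices of order at most `k`. -/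
def sobolevNorm {d : ℕ} (D : Set (Space d)) (k : ℕ) (v : L2 D) : ℝ :=
  √(∑ s ∈ Finset.range (k + 1), sobolevSeminorm D s v ^ 2)

lemma continuous_compact_partialDeriv {d : ℕ} (i : Fin d) {φ : Space d → ℂ}
    (h : ContDiff ℝ ∞ φ) (hc : HasCompactSupport φ) :
    ContDiff ℝ ∞ (partialDeriv i φ) ∧ HasCompactSupport (partialDeriv i φ) := by
  constructor
  · exact (h.fderiv_right (m := ∞) (by simp)).clm_apply contDiff_const
  · exact (hc.fderiv (𝕜 := ℝ)).comp_left (g := fun L : Space d →L[ℝ] ℂ =>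
      L (EuclideanSpace.single i 1)) rfl

lemma integrable_mul_of_compact {d : ℕ} {D : Set (Space d)} (u : L2 D) {ψ : Space d → ℂ}
    (h : Continuous ψ) (hc : HasCompactSupport ψ) :
    Integrable (fun x => u x * ψ x) (volume.restrict D) :=
  MemLp.integrable_mul (p := 2) (q := 2) (Lp.memLp u) (h.memLp_of_hasCompactSupport hc)

/-- The Sobolev space `H¹(D)`, as the space of pairs `(u, ∇u)` of a function `u ∈ L²(D)` and its
weak gradient in `L²(D)^d`. The topology inherited from the product is that of the `H¹`-norm. -/
def H1 {d : ℕ} (D : Set (Space d)) : Submodule ℂ (L2 D × (Fin d → L2 D)) where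
  carrier := {p | ∀ i, ∀ φ : Space d → ℂ, IsTestFunction D φ →
    ∫ x in D, p.1 x * partialDeriv i φ x = - ∫ x in D, p.2 i x * φ x}
  add_mem' := by
    intro p q hp hq i φ hφ
    obtain ⟨h1, h2⟩ := continuous_compact_partialDeriv i hφ.smooth hφ.compact
    have e1 : ∫ x in D, (p + q).1 x * partialDeriv i φ x =
        ∫ x in D, (p.1 x * partialDeriv i φ x + q.1 x * partialDeriv i φ x) := by
      refine integral_congr_ae ?_
      filter_upwards [Lp.coeFn_add p.1 q.1] with x hx
      rw [Prod.fst_add, hx, Pi.add_apply, add_mul]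
    have e2 : ∫ x in D, (p + q).2 i x * φ x =
        ∫ x in D, (p.2 i x * φ x + q.2 i x * φ x) := by
      refine integral_congr_ae ?_
      filter_upwards [Lp.coeFn_add (p.2 i) (q.2 i)] with x hx
      rw [Prod.snd_add, Pi.add_apply, hx, Pi.add_apply, add_mul]
    rw [e1, e2, integral_add (integrable_mul_of_compact _ h1.continuous h2)
      (integrable_mul_of_compact _ h1.continuous h2),
      integral_add (integrable_mul_of_compact _ hφ.smooth.continuous hφ.compact)
      (integrable_mul_of_compact _ hφ.smooth.continuous hφ.compact), hp i φ hφ, hq i φ hφ]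
    ring
  zero_mem' := by
    intro i φ _
    have e (ψ : Space d → ℂ) : ∫ x in D, (0 : L2 D) x * ψ x = 0 := by
      rw [← integral_zero (Space d) ℂ (μ := volume.restrict D)]
      refine integral_congr_ae ?_
      filter_upwards [Lp.coeFn_zero ℂ 2 (volume.restrict D)] with x hx
      rw [hx, Pi.zero_apply, zero_mul]
    rw [Prod.fst_zero, Prod.snd_zero, Pi.zero_apply, e, e, neg_zero]
  smul_mem' := by
    intro c p hp i φ hφ
    have e (f : L2 D) (ψ : Space d → ℂ) :
        ∫ x in D, (c • f) x * ψ x = c * ∫ x in D, f x * ψ x := by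
      rw [← integral_const_mul]
      refine integral_congr_ae ?_
      filter_upwards [Lp.coeFn_smul c f] with x hx
      rw [hx, Pi.smul_apply, smul_eq_mul, mul_assoc]
    rw [Prod.smul_fst, Prod.smul_snd, Pi.smul_apply, e, e, hp i φ hφ]
    ring

/-- The function `u ∈ L²(D)` underlying an element of `H¹(D)`. -/
def fn {d : ℕ} {D : Set (Space d)} (u : H1 D) : L2 D := u.1.1

/-- The weak partial derivatives `∂_i u ∈ L²(D)` of an element of `H¹(D)`. -/
def grad {d : ℕ} {D : Set (Space d)} (u : H1 D) (i : Fin d) : L2 D := u.1.2 i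

/-- `H¹₀(D)`: the closure of the test functions `C_c^∞(D)` in `H¹(D)`. -/
def H10 {d : ℕ} (D : Set (Space d)) : Set (H1 D) :=
  closure {v | ∃ φ : Space d → ℂ, IsTestFunction D φ ∧ fn v =ᵐ[volume.restrict D] φ}

/-! ### The sesquilinear form of the rotating Hamiltonian -/

/-- `x² + y²` for `d = 2, 3`. In one dimension there is no rotation and the value is set to `0`. -/
def planarSq {d : ℕ} (x : Space d) : ℝ :=
  if h : 2 ≤ d then x ⟨0, by omega⟩ ^ 2 + x ⟨1, h⟩ ^ 2 else 0

/-- The field `b(x)`, equal to `0` for `d = 1`, to `Ω (y, -x)` for `d = 2` and to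
`Ω (y, -x, 0)` for `d = 3`. -/
def rotField {d : ℕ} (Ω : ℝ) (x : Space d) (i : Fin d) : ℝ :=
  if h : 2 ≤ d then
    (if i.val = 0 then Ω * x ⟨1, h⟩ else if i.val = 1 then -(Ω * x ⟨0, by omega⟩) else 0)
  else 0

/-- The sesquilinear form
`(u, v)_𝓗 = ∫_D conj (∇u - (i/2) b u) · (∇v - (i/2) b v) + (V - |b|²/4) conj u v dx`. -/
def hForm {d : ℕ} {D : Set (Space d)} (Ω : ℝ) (V : Space d → ℝ) (u v : H1 D) : ℂ :=
  ∫ x in D,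
    ((∑ i, conj (grad u i x - Complex.I / 2 * (rotField Ω x i : ℂ) * fn u x)
          * (grad v i x - Complex.I / 2 * (rotField Ω x i : ℂ) * fn v x))
      + ((V x - (1 / 4) * ∑ i, rotField Ω x i ^ 2 : ℝ) : ℂ) * conj (fn u x) * fn v x)

/-! ### Space discretization -/

open Classical in
/-- The Ritz projection `P_h` onto the finite dimensional space `S`: the element `p = P_h v` of `S`
with `(v - p, w)_𝓗 = 0` for all `w ∈ S`. For `S ⊆ H¹₀(D)` and an admissible potential `(·,·)_𝓗` is a
scalar product on `S`, so that `p` exists and is unique. -/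
def ritz {d : ℕ} {D : Set (Space d)} (Ω : ℝ) (V : Space d → ℝ) (S : Submodule ℂ (H1 D))
    (v : H1 D) : H1 D :=
  if h : ∃ p ∈ S, ∀ w ∈ S, hForm Ω V (v - p) w = 0 then h.choose else 0

/-- Error estimate of the Ritz projection in `L²` and `H¹`:
`‖v - P_h v‖_{H^k} ≤ C h^{s-k} |v|_{H^s}` for `k = 0, 1`, `2 ≤ s ≤ r + 1`. -/
def RitzSobolevEstimate {d : ℕ} {D : Set (Space d)} (Ω : ℝ) (V : Space d → ℝ)
    (S : ℝ → Submodule ℂ (H1 D)) : Prop :=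
  ∃ r : ℕ, 1 ≤ r ∧ ∃ C > (0 : ℝ), ∃ h₀ > (0 : ℝ), ∀ k : ℕ, (k = 0 ∨ k = 1) →
    ∀ h : ℝ, 0 < h → h ≤ h₀ → ∀ s : ℕ, 2 ≤ s → s ≤ r + 1 →
      ∀ v ∈ H10 D, MemSobolev D s (fn v) →
        sobolevNorm D k (fn (v - ritz Ω V (S h) v)) ≤ C * h ^ (s - k) * sobolevSeminorm D s (fn v)

/-- Inverse estimate `‖v‖_{L^∞} ≤ C h^{-d/2} ‖v‖_{L²}` on `S_h`. -/
def InverseEstimate {d : ℕ} {D : Set (Space d)} (S : ℝ → Submodule ℂ (H1 D)) : Prop :=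
  ∃ C > (0 : ℝ), ∃ h₀ > (0 : ℝ), ∀ h : ℝ, 0 < h → h ≤ h₀ → ∀ v ∈ S h,
    eLpNorm (fn v) ∞ (volume.restrict D) ≤
      ENNReal.ofReal (C * h ^ (-(d : ℝ) / 2) * ‖fn v‖)

/-- Error estimate of the Ritz projection `‖v - P_h v‖_{L^∞} ≤ C |v|_{H²}`. -/
def RitzLinftyEstimate {d : ℕ} {D : Set (Space d)} (Ω : ℝ) (V : Space d → ℝ)
    (S : ℝ → Submodule ℂ (H1 D)) : Prop :=
  ∃ C > (0 : ℝ), ∃ h₀ > (0 : ℝ), ∀ h : ℝ, 0 < h → h ≤ h₀ →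
    ∀ v ∈ H10 D, MemSobolev D 2 (fn v) →
      eLpNorm (fn (v - ritz Ω V (S h) v)) ∞ (volume.restrict D) ≤
        ENNReal.ofReal (C * sobolevSeminorm D 2 (fn v))

/-! ### Time discretization and the fully discrete scheme -/

/-- A partition `0 = t_0 < t_1 < ⋯ < t_N = T` of `[0, T]`. -/
structure TimePartition (T : ℝ) where
  N : ℕ
  t : Fin (N + 1) → ℝ
  strictMono : StrictMono t
  first : t 0 = 0
  last : t (Fin.last N) = T

/-- The step sizes `τ_n = t_{n+1} - t_n`, `n = 0, …, N - 1`. -/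
def TimePartition.step {T : ℝ} (π : TimePartition T) (n : Fin π.N) : ℝ :=
  π.t n.succ - π.t n.castSucc

/-- The maximal step size `τ`. -/
def TimePartition.maxStep {T : ℝ} (π : TimePartition T) : ℝ :=
  ⨆ n : Fin π.N, π.step n

/-- Quasi-uniformity with constant `ρ`: `ρ τ ≤ min_n τ_n`. -/
def TimePartition.QuasiUniform {T : ℝ} (π : TimePartition T) (ρ : ℝ) : Prop :=
  ∀ n : Fin π.N, ρ * π.maxStep ≤ π.step n

/-- The space `V_q`: functions of `t ∈ (0, T]` with values in `S` which are polynomials of degree at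
most `q` in `t` on each `I_n = (t_n, t_{n+1}]`. -/
def MemV {d : ℕ} {D : Set (Space d)} {T : ℝ} (S : Submodule ℂ (H1 D)) (π : TimePartition T)
    (q : ℕ) (v : ℝ → H1 D) : Prop :=
  ∃ φ : Fin π.N → Fin (q + 1) → H1 D, (∀ n j, φ n j ∈ S) ∧
    ∀ n : Fin π.N, ∀ t ∈ Ioc (π.t n.castSucc) (π.t n.succ),
      v t = ∑ j : Fin (q + 1), ((t : ℂ) ^ (j : ℕ)) • φ n j

/-- The pairing `(|u|² u, v) = ∫_D conj (|u|² u) v dx`. -/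
def cubicPairing {d : ℕ} {D : Set (Space d)} (u v : H1 D) : ℂ :=
  ∫ x in D, conj (((‖fn u x‖ ^ 2 : ℝ) : ℂ) * fn u x) * fn v x

/-- `u` solves the fully discrete cG(`q`) scheme with finite element space `S`, time partition `π`
and initial value `u₀`: `u ∈ V_q`, for every `n` and every `v ∈ V_{q-1}`
`∫_{I_n} (i ∂_t u, v) - (u, v)_𝓗 - β (|u|² u, v) dt = 0`,
and the right limits satisfy `u(t_n +) = u(t_n)` for `n ≥ 1` and `u(0 +) = P_h u₀`.
The values of `u` outside `(0, T]` carry no information. -/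
structure IsDiscreteSolution {d : ℕ} {D : Set (Space d)} {T : ℝ} (Ω β : ℝ) (V : Space d → ℝ)
    (S : Submodule ℂ (H1 D)) (π : TimePartition T) (q : ℕ) (u₀ : H1 D) (u : ℝ → H1 D) :
    Prop where
  mem : MemV S π q u
  eqn : ∀ n : Fin π.N, ∀ v : ℝ → H1 D, MemV S π (q - 1) v →
    ∫ t in (π.t n.castSucc)..(π.t n.succ),
      (inner ℂ (Complex.I • deriv (fun s => fn (u s)) t) (fn (v t))
        - hForm Ω V (u t) (v t) - (β : ℂ) * cubicPairing (u t) (v t)) = 0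
  jump : ∀ n : Fin π.N, n.val ≠ 0 →
    Tendsto u (𝓝[>] (π.t n.castSucc)) (𝓝 (u (π.t n.castSucc)))
  init : Tendsto u (𝓝[>] 0) (𝓝 (ritz Ω V S u₀))

/-- The norm `‖u‖_{L^∞(I × D)} = ess sup_{t ∈ I} ‖u(t)‖_{L^∞(D)}`, `I = [0, T)`. -/
def linftyNorm {d : ℕ} {D : Set (Space d)} (T : ℝ) (u : ℝ → H1 D) : ℝ≥0∞ :=
  essSup (fun t => eLpNorm (fn (u t)) ∞ (volume.restrict D)) (volume.restrict (Ico 0 T))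

/-- A family `U h π` of fully discrete solutions, for all `0 < h < h₁` and all quasi-uniform
partitions `π` of `[0, T]` with maximal step size less than `τ₁`, that is uniformly bounded by `M`:
`‖U h π‖_{L^∞(I × D)} < M`. -/
def IsBoundedSolutionFamily {d : ℕ} {D : Set (Space d)} {T : ℝ} (Ω β : ℝ) (V : Space d → ℝ)
    (S : ℝ → Submodule ℂ (H1 D)) (ρ : ℝ) (q : ℕ) (u₀ : H1 D) (M τ₁ h₁ : ℝ)
    (U : ℝ → TimePartition T → ℝ → H1 D) : Prop :=
  ∀ h : ℝ, 0 < h → h < h₁ → ∀ π : TimePartition T, π.QuasiUniform ρ → π.maxStep < τ₁ →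
    IsDiscreteSolution Ω β V (S h) π q u₀ (U h π) ∧ linftyNorm T (U h π) < ENNReal.ofReal M

end GPE

end

/-! Uniqueness is proved one time interval `(a, b]` at a time. Two solutions with the same right
limit at `a` differ there by an `S`-valued polynomial of degree at most `q` that vanishes at `a`, so
the difference is `(t - a) χ` with `χ` of degree at most `q - 1`. Hence `χ` is itself an admissible
test function (`exists_polyEval_eq_sub_smul`). Subtract the two equations tested with `χ` and take
imaginary parts. The Hamiltonian term `(t - a) (χ, χ)_𝓗` is real and disappears, so no inverse
estimate is needed and the step restriction does not depend on `h`. The time derivative contributes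
`Re (χ + (t - a) χ', χ)`, whose integral is half of `∫ ‖χ‖² + (b - a) ‖χ(b)‖²`, with norms in
`L²(D)`. The cubic term is Lipschitz on bounded sets and contributes at most `3 β M² (b - a) ∫
‖χ‖²`. If `6 β M² (b - a) < 1`, then `χ = 0`.

The absorption is `eq_zero_of_integral_inner_deriv`, a single step is `polyEval_eq_of_scheme`, and
induction over the nodes (`eqOn_of_isDiscreteSolution`) gives the theorem. The `L^∞` bound is also
needed for integrability: it puts every coefficient of the polynomials in `L^∞`
(`coeff_mem_boundedH1`), so that the integrals can be split. -/

namespace GPE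

/-! ### Vector-valued polynomials in time. -/

section Polynomials

variable {E : Type*} [AddCommGroup E] [Module ℂ E]

/-- The `E`-valued polynomial `∑ t^j φ_j` of a real variable. -/
def polyEval {m : ℕ} (φ : Fin m → E) (t : ℝ) : E :=
  ∑ j : Fin m, ((t : ℂ) ^ (j : ℕ)) • φ j

/-- If a polynomial takes values in a subspace at infinitely many points, then its coefficients lie
in that subspace. -/
lemma coeff_mem_of_infinite (W : Submodule ℂ E) {m : ℕ} (φ : Fin m → E) {s : Set ℝ}
    (hs : s.Infinite) (h : ∀ t ∈ s, polyEval φ t ∈ W) (j : Fin m) :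
    φ j ∈ W := by
  -- Modulo `W` and after applying a linear functional, this is a scalar polynomial with infinitely
  -- many roots.
  rw [← Submodule.Quotient.mk_eq_zero, ← Module.forall_dual_apply_eq_zero_iff ℂ]
  intro f
  let P : Polynomial ℂ := ∑ i : Fin m, Polynomial.monomial (i : ℕ) (f (W.mkQ (φ i)))
  have hP : P = 0 := by
    refine Polynomial.eq_zero_of_infinite_isRoot P
      ((hs.image Complex.ofReal_injective.injOn).mono ?_)
    rintro _ ⟨t, ht, rfl⟩
    have h1 := congrArg f ((Submodule.Quotient.mk_eq_zero W).2 (h t ht))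
    rw [← Submodule.mkQ_apply] at h1
    simp only [polyEval, map_sum, map_smul, smul_eq_mul, map_zero] at h1
    simp only [mem_ofPred_eq, Polynomial.IsRoot.def, P, Polynomial.eval_finsetSum,
      Polynomial.eval_monomial]
    rw [← h1]
    exact Finset.sum_congr rfl fun i _ => mul_comm _ _
  have h2 := congrArg (fun p : Polynomial ℂ => p.coeff j) hP
  simpa [P, Polynomial.finsetSum_coeff, Polynomial.coeff_monomial, Fin.val_inj] using h2

/-- A polynomial that vanishes at `a` is divisible by `t - a`. -/
lemma exists_polyEval_eq_sub_smul (W : Submodule ℂ E) {m : ℕ} (ψ : Fin (m + 1) → E)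
    (hψ : ∀ j, ψ j ∈ W) (a : ℝ) (ha : polyEval ψ a = 0) :
    ∃ χ : Fin m → E, (∀ j, χ j ∈ W) ∧ ∀ t : ℝ, polyEval ψ t = ((t - a : ℝ) : ℂ) • polyEval χ t := by
  -- The coefficients come from `t^j - a^j = (t - a) ∑_{i<j} t^i a^(j-1-i)`, summed against `ψ j`.
  refine ⟨fun i => ∑ j : Fin (m + 1),
    (if (i : ℕ) < j then (a : ℂ) ^ ((j : ℕ) - 1 - i) else 0) • ψ j, fun i =>
    W.sum_mem fun j _ => W.smul_mem _ (hψ j), fun t => ?_⟩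
  unfold polyEval at ha ⊢
  have e1 : ∑ j : Fin (m + 1), ((t : ℂ) ^ (j : ℕ)) • ψ j =
      ∑ j : Fin (m + 1), ((t : ℂ) ^ (j : ℕ) - (a : ℂ) ^ (j : ℕ)) • ψ j := by
    simp only [sub_smul, Finset.sum_sub_distrib, ha, sub_zero]
  rw [e1]
  simp only [Finset.smul_sum]
  rw [Finset.sum_comm]
  refine Finset.sum_congr rfl fun j _ => ?_
  simp only [smul_smul, ← Finset.sum_smul]
  congr 1
  rw [← Finset.mul_sum, ← geom_sum₂_mul, Complex.ofReal_sub, mul_comm, Finset.sum_fin_eq_sum_range]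
  congr 1
  have hj : (j : ℕ) ≤ m := Nat.lt_succ_iff.1 j.2
  -- The coefficients vanish for `i ≥ j`, so the geometric sum over `i < j` may run over all `i <
  -- m`.
  rw [← Finset.sum_subset (Finset.range_subset_range.2 hj)]
  · refine Finset.sum_congr rfl fun i hi => ?_
    rw [Finset.mem_range] at hi
    rw [dif_pos (hi.trans_le hj), if_pos hi]
  · intro i _ hi
    rw [Finset.mem_range] at hi
    split_ifs <;> simp

end Polynomials

/-! ### The energy argument and the Lipschitz bound. -/

/-- `P` vanishes if `(t - a) P` satisfies, in the mean and tested with `P`, a differential equation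
with a sufficiently small right-hand side. -/
lemma eq_zero_of_integral_inner_deriv {E : Type*} [NormedAddCommGroup E] [InnerProductSpace ℂ E]
    {P P' : ℝ → E} (hP : ∀ t, HasDerivAt P (P' t) t) (hP' : Continuous P') {a b K : ℝ}
    (hab : a < b) (hK : 0 ≤ K) (hKab : 2 * K * (b - a) < 1) {c : ℝ → ℝ}
    (hc : ContinuousOn c (Icc a b))
    (hcK : ∀ᵐ t ∂volume.restrict (Ioc a b), |c t| ≤ K * ((t - a) * ‖P t‖ ^ 2))
    (h : ∫ t in a..b, ((inner ℂ (P t + ((t - a : ℝ) : ℂ) • P' t) (P t)).re + c t) = 0) :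
    ∀ t ∈ Icc a b, P t = 0 := by
  have hPc : Continuous P := continuous_iff_continuousAt.2 fun t => (hP t).continuousAt
  have hPn : Continuous fun t => ‖P t‖ ^ 2 := by fun_prop
  have hci : IntervalIntegrable c volume a b :=
    ContinuousOn.intervalIntegrable (by rwa [uIcc_of_le hab.le])
  have hin : Continuous fun t => (inner ℂ (P' t) (P t)).re :=
    Complex.continuous_re.comp (hP'.inner hPc)
  have hsplit : ∀ t, (inner ℂ (P t + ((t - a : ℝ) : ℂ) • P' t) (P t)).re =
      ‖P t‖ ^ 2 + (t - a) * (inner ℂ (P' t) (P t)).re := by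
    intro t
    rw [inner_add_left, inner_smul_left, Complex.add_re, Complex.conj_ofReal,
      Complex.re_ofReal_mul]
    congr 1
    exact inner_self_eq_norm_sq (𝕜 := ℂ) (P t)
  -- The weighted energy `(t - a) ‖P‖²` vanishes at `a` and is nonnegative at `b`, so its boundary
  -- terms have a favourable sign.
  have hD : ∀ t, HasDerivAt (fun t => (t - a) * ‖P t‖ ^ 2)
      (‖P t‖ ^ 2 + 2 * ((t - a) * (inner ℂ (P' t) (P t)).re)) t := by
    intro t
    have h1 : HasDerivAt (fun t => (inner ℂ (P t) (P t)).re)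
        ((inner ℂ (P t) (P' t) + inner ℂ (P' t) (P t)).re) t :=
      Complex.reCLM.hasFDerivAt.comp_hasDerivAt t ((hP t).inner ℂ (hP t))
    have h2 : (fun t => (inner ℂ (P t) (P t)).re) = fun t => ‖P t‖ ^ 2 :=
      funext fun t => inner_self_eq_norm_sq (𝕜 := ℂ) (P t)
    rw [h2] at h1
    have h3 := ((hasDerivAt_id t).sub_const a).mul h1
    refine h3.congr_deriv ?_
    have h4 : (inner ℂ (P t) (P' t)).re = (inner ℂ (P' t) (P t)).re :=
      inner_re_symm (𝕜 := ℂ) _ _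
    simp only [id, Complex.add_re, h4]
    ring
  have hFTC := intervalIntegral.integral_eq_sub_of_hasDerivAt (a := a) (b := b)
    (fun t _ => hD t) (Continuous.intervalIntegrable (by fun_prop) _ _)
  have hI1 : IntervalIntegrable (fun t => ‖P t‖ ^ 2) volume a b := hPn.intervalIntegrable _ _
  have hI2 : IntervalIntegrable (fun t => (t - a) * (inner ℂ (P' t) (P t)).re) volume a b :=
    Continuous.intervalIntegrable (by fun_prop) _ _
  simp only [hsplit] at h
  rw [intervalIntegral.integral_add (hI1.add hI2) hci, intervalIntegral.integral_add hI1 hI2] at h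
  rw [intervalIntegral.integral_add hI1 (hI2.const_mul 2), intervalIntegral.integral_const_mul,
    sub_self, zero_mul, sub_zero] at hFTC
  have hbound : |∫ t in a..b, c t| ≤ K * (b - a) * ∫ t in a..b, ‖P t‖ ^ 2 := by
    rw [← intervalIntegral.integral_const_mul, ← Real.norm_eq_abs]
    refine intervalIntegral.norm_integral_le_of_norm_le hab.le ?_ (hI1.const_mul _)
    filter_upwards [(ae_restrict_iff' measurableSet_Ioc).1 hcK] with t ht hmem
    refine (ht hmem).trans ?_
    rw [mul_assoc]
    have := hmem.2
    gcongr
  have hnn : 0 ≤ ∫ t in a..b, ‖P t‖ ^ 2 :=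
    intervalIntegral.integral_nonneg hab.le fun t _ => by positivity
  have hb : 0 ≤ (b - a) * ‖P b‖ ^ 2 := mul_nonneg (sub_nonneg.2 hab.le) (by positivity)
  -- Eliminating the integral of `(t - a) Re (P', P)` between `h` and `hFTC` gives `∫ ‖P‖² ≤ 2 |∫ c|
  -- ≤ 2 K (b - a) ∫ ‖P‖²`, with a factor below `1`.
  have hzero : ∫ t in a..b, ‖P t‖ ^ 2 = 0 := by
    have := (abs_le.1 hbound).1
    nlinarith
  intro t ht
  by_contra hne
  have : 0 < ∫ t in a..b, ‖P t‖ ^ 2 :=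
    intervalIntegral.integral_pos hab hPn.continuousOn (fun t _ => by positivity)
      ⟨t, ht, by have := norm_pos_iff.2 hne; positivity⟩
  exact this.ne' hzero

/-- Lipschitz estimate for the cubic nonlinearity on a ball. -/
lemma norm_cubic_sub_le {M : ℝ} {z w : ℂ} (hz : ‖z‖ ≤ M) (hw : ‖w‖ ≤ M) :
    ‖((‖z‖ ^ 2 : ℝ) : ℂ) * z - ((‖w‖ ^ 2 : ℝ) : ℂ) * w‖ ≤ 3 * M ^ 2 * ‖z - w‖ := by
  -- The first summand costs `M²` and the second `2 M²`, which gives the constant `3 M²`.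
  have e : ((‖z‖ ^ 2 : ℝ) : ℂ) * z - ((‖w‖ ^ 2 : ℝ) : ℂ) * w =
      ((‖z‖ ^ 2 : ℝ) : ℂ) * (z - w) + (((‖z‖ + ‖w‖) * (‖z‖ - ‖w‖) : ℝ) : ℂ) * w := by
    push_cast; ring
  have h0 : 0 ≤ M := (norm_nonneg z).trans hz
  have h1 := abs_norm_sub_norm_le z w
  rw [e]
  refine (norm_add_le _ _).trans ?_
  rw [norm_mul, norm_mul, Complex.norm_real, Complex.norm_real, Real.norm_eq_abs, Real.norm_eq_abs,
    abs_mul, abs_of_nonneg (by positivity : 0 ≤ ‖z‖ ^ 2),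
    abs_of_nonneg (by positivity : 0 ≤ ‖z‖ + ‖w‖)]
  calc _ ≤ M ^ 2 * ‖z - w‖ + (M + M) * ‖z - w‖ * M := by gcongr
    _ = _ := by ring

/-! ### Passage between `H¹(D)` and `L²(D)`. -/

variable {d : ℕ} {D : Set (Space d)}

/-- The embedding of `H¹(D)` into `L²(D)`. -/
noncomputable def fnL (D : Set (Space d)) : H1 D →L[ℂ] L2 D :=
  (ContinuousLinearMap.fst ℂ (L2 D) (Fin d → L2 D)).comp (H1 D).subtypeL

lemma fnL_apply (u : H1 D) : fnL D u = fn u := rfl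

lemma contDiff_polyEval {E : Type*} [NormedAddCommGroup E] [NormedSpace ℂ E] {m : ℕ}
    (φ : Fin m → E) : ContDiff ℝ ∞ (polyEval φ) := by
  unfold polyEval
  refine ContDiff.sum fun j _ => ContDiff.smul ?_ contDiff_const
  exact (Complex.ofRealCLM.contDiff).pow _

lemma isFiniteMeasure_restrict (hD : IsConvexPolyhedralDomain D) :
    IsFiniteMeasure (volume.restrict D) :=
  ⟨by rw [Measure.restrict_apply_univ]; exact hD.bounded.measure_lt_top⟩

/-- An element of `H¹(D)` is determined by its underlying function. -/
lemma fn_injective (hD : IsConvexPolyhedralDomain D) : Function.Injective (fn (D := D)) := by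
  have := isFiniteMeasure_restrict hD
  have key : ∀ u : H1 D, fn u = 0 → u = 0 := by
    intro u hu
    refine Subtype.ext (Prod.ext hu (funext fun i => ?_))
    change grad u i = 0
    rw [Lp.eq_zero_iff_ae_eq_zero]
    have hint : Integrable (grad u i) (volume.restrict D) :=
      (Lp.memLp (grad u i)).integrable (by norm_num)
    -- Fundamental lemma of the calculus of variations: the weak gradient of the zero function
    -- integrates to zero against every real test function.
    refine (ae_restrict_iff' hD.isOpen.measurableSet).2
      (hD.isOpen.ae_eq_zero_of_integral_contDiff_smul_eq_zero
        (IntegrableOn.locallyIntegrableOn hint) fun g hg hgc hgs => ?_)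
    have hφ : IsTestFunction D (fun x => (g x : ℂ)) := by
      refine ⟨Complex.ofRealCLM.contDiff.comp hg, hgc.comp_left (g := Complex.ofReal) rfl, ?_⟩
      exact (tsupport_comp_subset (g := Complex.ofReal) Complex.ofReal_zero g).trans hgs
    have h1 := u.2 i _ hφ
    have h2 : ∫ x in D, u.1.1 x * partialDeriv i (fun x => (g x : ℂ)) x = 0 := by
      rw [show u.1.1 = 0 from hu]
      refine integral_eq_zero_of_ae ?_
      filter_upwards [Lp.coeFn_zero ℂ 2 (volume.restrict D)] with x hx
      rw [hx]
      exact zero_mul _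
    rw [h2, eq_comm, neg_eq_zero] at h1
    rw [← h1, ← setIntegral_eq_integral_of_forall_compl_eq_zero (s := D)]
    · refine integral_congr_ae (ae_of_all _ fun x => ?_)
      change g x • (grad u i x) = grad u i x * _
      rw [Complex.real_smul, mul_comm]
    · intro x hx
      rw [image_eq_zero_of_notMem_tsupport fun h => hx (hgs h), zero_smul]
  intro u v huv
  rw [← sub_eq_zero]
  refine key _ ?_
  rw [← fnL_apply, map_sub, fnL_apply, fnL_apply, huv, sub_self]

/-! ### The sesquilinear form -/

/-- The `i`-th component of `∇u - (i/2) b u`. -/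
noncomputable def covGrad (Ω : ℝ) (u : H1 D) (i : Fin d) (x : Space d) : ℂ :=
  grad u i x - Complex.I / 2 * (rotField Ω x i : ℂ) * fn u x

lemma continuous_rotField (Ω : ℝ) (i : Fin d) : Continuous fun x : Space d => rotField Ω x i := by
  unfold rotField
  split_ifs <;> fun_prop

lemma memLp_top_of_continuous (hD : IsConvexPolyhedralDomain D) {F : Type*} [NormedAddCommGroup F]
    {f : Space d → F} (hf : Continuous f) : MemLp f ∞ (volume.restrict D) := by
  have hc : IsCompact (closure D) := hD.bounded.isCompact_closure
  obtain ⟨C, hC⟩ := hc.exists_bound_of_continuousOn hf.continuousOn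
  refine memLp_top_of_bound hf.aestronglyMeasurable C ?_
  filter_upwards [ae_restrict_mem hD.isOpen.measurableSet] with x hx
  exact hC x (subset_closure hx)

lemma memLp_covGrad (hD : IsConvexPolyhedralDomain D) (Ω : ℝ) (u : H1 D) (i : Fin d) :
    MemLp (covGrad Ω u i) 2 (volume.restrict D) := by
  have hb : MemLp (fun x : Space d => Complex.I / 2 * (rotField Ω x i : ℂ)) ∞
      (volume.restrict D) :=
    memLp_top_of_continuous hD
      (continuous_const.mul (Complex.continuous_ofReal.comp (continuous_rotField Ω i)))
  exact (Lp.memLp (grad u i)).sub ((Lp.memLp (fn u)).mul (r := 2) hb)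

lemma hForm_eq (Ω : ℝ) (V : Space d → ℝ) (u v : H1 D) :
    hForm Ω V u v = ∫ x in D, ((∑ i, conj (covGrad Ω u i x) * covGrad Ω v i x) +
      ((V x - (1 / 4) * ∑ i, rotField Ω x i ^ 2 : ℝ) : ℂ) * conj (fn u x) * fn v x) := rfl

lemma integrable_hForm (hD : IsConvexPolyhedralDomain D) (Ω : ℝ) {V : Space d → ℝ}
    (hV : MemLp V ∞ (volume.restrict D)) (u v : H1 D) :
    Integrable (fun x => (∑ i, conj (covGrad Ω u i x) * covGrad Ω v i x) +
      ((V x - (1 / 4) * ∑ i, rotField Ω x i ^ 2 : ℝ) : ℂ) * conj (fn u x) * fn v x)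
      (volume.restrict D) := by
  refine Integrable.add (integrable_finsetSum _ fun i _ => ?_) ?_
  · exact MemLp.integrable_mul (p := 2) (q := 2) (memLp_covGrad hD Ω u i).star
      (memLp_covGrad hD Ω v i)
  · have h1 : MemLp (fun x => V x - (1 / 4) * ∑ i, rotField Ω x i ^ 2) ∞ (volume.restrict D) :=
      hV.sub (memLp_top_of_continuous hD (continuous_const.mul
        (continuous_finsetSum _ fun i _ => (continuous_rotField Ω i).pow 2)))
    have h2 : MemLp (fun x => ((V x - (1 / 4) * ∑ i, rotField Ω x i ^ 2 : ℝ) : ℂ)) ∞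
      (volume.restrict D) := h1.ofReal
    have h3 := (Lp.memLp (fn u)).star.mul (r := 2) h2
    exact MemLp.integrable_mul (p := 2) (q := 2) h3 (Lp.memLp (fn v))

/-- The zeroth-order weight `V - |b|²/4` is real, so the form is Hermitian. Linearity in the second
argument then yields conjugate linearity in the first. -/
lemma conj_hForm (Ω : ℝ) (V : Space d → ℝ) (u v : H1 D) :
    conj (hForm Ω V u v) = hForm Ω V v u := by
  rw [hForm_eq, hForm_eq, ← integral_conj]
  refine integral_congr_ae (ae_of_all _ fun x => ?_)
  simp only [map_add, map_sum, map_mul, Complex.conj_conj, Complex.conj_ofReal]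
  congr 1
  · exact Finset.sum_congr rfl fun i _ => mul_comm _ _
  · ring

lemma hForm_add_right (hD : IsConvexPolyhedralDomain D) (Ω : ℝ) {V : Space d → ℝ}
    (hV : MemLp V ∞ (volume.restrict D)) (u v w : H1 D) :
    hForm Ω V u (v + w) = hForm Ω V u v + hForm Ω V u w := by
  rw [hForm_eq, hForm_eq, hForm_eq,
    ← integral_add (integrable_hForm hD Ω hV u v) (integrable_hForm hD Ω hV u w)]
  refine integral_congr_ae ?_
  have hg : ∀ᵐ x ∂volume.restrict D, ∀ i, grad (v + w) i x = grad v i x + grad w i x :=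
    ae_all_iff.2 fun i => Lp.coeFn_add (grad v i) (grad w i)
  filter_upwards [hg, Lp.coeFn_add (fn v) (fn w)] with x hx hf
  have hf' : fn (v + w) x = fn v x + fn w x := hf
  have hc : ∀ i, covGrad Ω (v + w) i x = covGrad Ω v i x + covGrad Ω w i x := fun i => by
    rw [covGrad, covGrad, covGrad, hx, hf']; ring
  simp only [hc, hf', mul_add, Finset.sum_add_distrib]
  ring

lemma hForm_smul_right (Ω : ℝ) (V : Space d → ℝ) (c : ℂ) (u v : H1 D) :
    hForm Ω V u (c • v) = c * hForm Ω V u v := by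
  rw [hForm_eq, hForm_eq, ← integral_const_mul]
  refine integral_congr_ae ?_
  have hg : ∀ᵐ x ∂volume.restrict D, ∀ i, grad (c • v) i x = c * grad v i x :=
    ae_all_iff.2 fun i => Lp.coeFn_smul c (grad v i)
  filter_upwards [hg, Lp.coeFn_smul c (fn v)] with x hx hf
  have hf' : fn (c • v) x = c * fn v x := hf
  have hc : ∀ i, covGrad Ω (c • v) i x = c * covGrad Ω v i x := fun i => by
    rw [covGrad, covGrad, hx, hf']; ring
  simp only [hc, hf', mul_add, Finset.mul_sum]
  congr 1
  · exact Finset.sum_congr rfl fun i _ => by ring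
  · ring

/-- `(·,·)_𝓗` as a bundled sesquilinear form. -/
noncomputable def hSesq (hD : IsConvexPolyhedralDomain D) (Ω : ℝ) {V : Space d → ℝ}
    (hV : MemLp V ∞ (volume.restrict D)) : H1 D →ₗ⋆[ℂ] H1 D →ₗ[ℂ] ℂ :=
  LinearMap.mk₂'ₛₗ (starRingEnd ℂ) (RingHom.id ℂ) (hForm Ω V)
    (fun u v w => by
      rw [← conj_hForm, hForm_add_right hD Ω hV, map_add, conj_hForm, conj_hForm])
    (fun c u w => by rw [← conj_hForm, hForm_smul_right, map_mul, conj_hForm, smul_eq_mul])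
    (fun u v w => hForm_add_right hD Ω hV u v w)
    (fun c u v => hForm_smul_right Ω V c u v)

lemma hForm_sub_left (hD : IsConvexPolyhedralDomain D) (Ω : ℝ) {V : Space d → ℝ}
    (hV : MemLp V ∞ (volume.restrict D)) (u v w : H1 D) :
    hForm Ω V u w - hForm Ω V v w = hForm Ω V (u - v) w := by
  change hSesq hD Ω hV u w - hSesq hD Ω hV v w = hSesq hD Ω hV (u - v) w
  simp

/-- Hermitian symmetry makes the diagonal real. This removes the Hamiltonian from the imaginary part
of the tested equation. -/
lemma hForm_ofReal_smul_self_im (Ω : ℝ) (V : Space d → ℝ) (c : ℝ) (u : H1 D) :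
    (hForm Ω V ((c : ℂ) • u) u).im = 0 := by
  rw [← conj_hForm, hForm_smul_right, map_mul, Complex.conj_ofReal, conj_hForm,
    Complex.im_ofReal_mul, Complex.conj_eq_iff_im.1 (conj_hForm Ω V u u), mul_zero]

/-- Sesquilinear expansion leaves a finite sum of powers of `t` and their conjugates with constant
coefficients; no continuity of the form on `H¹(D)` is needed. -/
lemma continuous_hForm_polyEval (hD : IsConvexPolyhedralDomain D) (Ω : ℝ) {V : Space d → ℝ}
    (hV : MemLp V ∞ (volume.restrict D)) {m n : ℕ} (φ : Fin m → H1 D) (χ : Fin n → H1 D) :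
    Continuous fun t => hForm Ω V (polyEval φ t) (polyEval χ t) := by
  change Continuous fun t => hSesq hD Ω hV (polyEval φ t) (polyEval χ t)
  simp only [polyEval, map_sum, LinearMap.sum_apply, LinearMap.map_smulₛₗ, LinearMap.smul_apply,
    RingHom.id_apply, starRingEnd_apply]
  fun_prop

/-! ### The cubic term -/

lemma coeFn_polyEval {m : ℕ} (φ : Fin m → H1 D) (t : ℝ) :
    fn (polyEval φ t) =ᵐ[volume.restrict D] fun x => polyEval (fun j => fn (φ j) x) t := by
  rw [← fnL_apply, polyEval, map_sum]
  simp only [map_smul, fnL_apply]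
  refine (Lp.coeFn_fun_finsetSum _ _).trans ?_
  have : ∀ᵐ x ∂volume.restrict D, ∀ j : Fin m,
      (((t : ℂ) ^ (j : ℕ)) • fn (φ j)) x = ((t : ℂ) ^ (j : ℕ)) • fn (φ j) x :=
    ae_all_iff.2 fun j => Lp.coeFn_smul _ _
  filter_upwards [this] with x hx
  simp only [hx, polyEval]

/-- The elements of `H¹(D)` which are essentially bounded. -/
def boundedH1 (D : Set (Space d)) : Submodule ℂ (H1 D) where
  carrier := {u | MemLp (fn u) ∞ (volume.restrict D)}
  add_mem' := fun {u v} hu hv => (MemLp.add hu hv).ae_eq (Lp.coeFn_add (fn u) (fn v)).symm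
  zero_mem' := (MemLp.zero' (p := ∞)).ae_eq (Lp.coeFn_zero ℂ 2 (volume.restrict D)).symm
  smul_mem' := fun c u hu => (MemLp.const_smul hu c).ae_eq (Lp.coeFn_smul c (fn u)).symm

lemma norm_polyEval_le {m : ℕ} (z : Fin m → ℂ) {t b : ℝ} (ht : 0 ≤ t) (htb : t ≤ b) :
    ‖polyEval z t‖ ≤ ∑ j : Fin m, b ^ (j : ℕ) * ‖z j‖ := by
  refine (norm_sum_le _ _).trans (Finset.sum_le_sum fun j _ => ?_)
  rw [norm_smul, norm_pow, Complex.norm_real, Real.norm_eq_abs, abs_of_nonneg ht]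
  gcongr

lemma cubicPairing_polyEval {m n : ℕ} (φ : Fin m → H1 D) (χ : Fin n → H1 D) (t : ℝ) :
    cubicPairing (polyEval φ t) (polyEval χ t) =
      ∫ x in D, conj (((‖polyEval (fun j => fn (φ j) x) t‖ ^ 2 : ℝ) : ℂ) *
        polyEval (fun j => fn (φ j) x) t) * polyEval (fun j => fn (χ j) x) t := by
  refine integral_congr_ae ?_
  filter_upwards [coeFn_polyEval φ t, coeFn_polyEval χ t] with x h1 h2
  rw [h1, h2]

lemma aestronglyMeasurable_polyEval {m : ℕ} (φ : Fin m → H1 D) (t : ℝ) :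
    AEStronglyMeasurable (fun x => polyEval (fun j => fn (φ j) x) t) (volume.restrict D) :=
  (Lp.memLp (fn (polyEval φ t))).aestronglyMeasurable.congr (coeFn_polyEval φ t)

/-- Dominated convergence: bounded coefficients give a bound on the first argument that is uniform
in time, and the second argument is dominated by an integrable function because `D` has finite
measure. -/
lemma continuousOn_cubicPairing (hD : IsConvexPolyhedralDomain D) {m n : ℕ} (φ : Fin m → H1 D)
    (hφ : ∀ j, φ j ∈ boundedH1 D) (χ : Fin n → H1 D) {a b : ℝ} (ha : 0 ≤ a) :
    ContinuousOn (fun t => cubicPairing (polyEval φ t) (polyEval χ t)) (Icc a b) := by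
  have := isFiniteMeasure_restrict hD
  simp only [cubicPairing_polyEval]
  have hC : ∀ j, ∃ C : ℝ, ∀ᵐ x ∂volume.restrict D, ‖fn (φ j) x‖ ≤ C := fun j =>
    ⟨lpNorm (fn (φ j)) ∞ (volume.restrict D), ae_le_lpNorm_exponent_top (hφ j)⟩
  choose C hC using hC
  let A : ℝ := ∑ j : Fin m, b ^ (j : ℕ) * C j
  refine continuousOn_of_dominated
    (bound := fun x => A ^ 3 * ∑ k : Fin n, b ^ (k : ℕ) * ‖fn (χ k) x‖) ?_ ?_ ?_ ?_
  · intro t _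
    have h1 := aestronglyMeasurable_polyEval φ t
    exact (((Complex.continuous_ofReal.comp_aestronglyMeasurable (h1.norm.pow 2)).mul h1).star).mul
      (aestronglyMeasurable_polyEval χ t)
  · intro t ht
    have ht0 := ha.trans ht.1
    have hb0 := ht0.trans ht.2
    filter_upwards [ae_all_iff.2 hC] with x h3
    have h4 : ‖polyEval (fun j => fn (φ j) x) t‖ ≤ A := by
      refine (norm_polyEval_le _ ht0 ht.2).trans (Finset.sum_le_sum fun j _ => ?_)
      have := h3 j
      gcongr
    have h5 := norm_polyEval_le (fun j => fn (χ j) x) ht0 ht.2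
    rw [norm_mul, RCLike.norm_conj, norm_mul, Complex.norm_real, norm_pow, norm_norm, ← pow_succ]
    have hA : 0 ≤ A := (norm_nonneg _).trans h4
    gcongr
  · refine (integrable_finsetSum _ fun k _ => Integrable.const_mul ?_ _).const_mul _
    exact ((Lp.memLp (fn (χ k))).integrable (by norm_num)).norm
  · refine ae_of_all _ fun x => Continuous.continuousOn ?_
    have h1 := (contDiff_polyEval fun j => fn (φ j) x).continuous
    have h2 := (contDiff_polyEval fun j => fn (χ j) x).continuous
    exact (Complex.continuous_conj.comp
      ((Complex.continuous_ofReal.comp (h1.norm.pow 2)).mul h1)).mul h2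

lemma integrable_cubicPairing (hD : IsConvexPolyhedralDomain D) {u : H1 D} {M : ℝ}
    (hu : ∀ᵐ x ∂volume.restrict D, ‖fn u x‖ ≤ M) (v : H1 D) :
    Integrable (fun x => conj (((‖fn u x‖ ^ 2 : ℝ) : ℂ) * fn u x) * fn v x)
      (volume.restrict D) := by
  have := isFiniteMeasure_restrict hD
  have h1 := (Lp.memLp (fn u)).aestronglyMeasurable
  refine MemLp.integrable_mul (p := 2) (q := 2) ?_ (Lp.memLp (fn v))
  refine MemLp.of_bound
    ((Complex.continuous_ofReal.comp_aestronglyMeasurable (h1.norm.pow 2)).mul h1).star (M ^ 3) ?_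
  filter_upwards [hu] with x hx
  change ‖conj (((‖fn u x‖ ^ 2 : ℝ) : ℂ) * fn u x)‖ ≤ M ^ 3
  rw [RCLike.norm_conj, norm_mul, Complex.norm_real, norm_pow, norm_norm,
    ← pow_succ]
  gcongr

/-- With `r = t - a` and `w = χ`, this is the right-hand side that the energy argument absorbs. -/
lemma norm_cubicPairing_sub_le (hD : IsConvexPolyhedralDomain D) {u v w : H1 D} {M r : ℝ}
    (hr : 0 ≤ r) (hu : ∀ᵐ x ∂volume.restrict D, ‖fn u x‖ ≤ M)
    (hv : ∀ᵐ x ∂volume.restrict D, ‖fn v x‖ ≤ M) (hw : u - v = (r : ℂ) • w) :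
    ‖cubicPairing u w - cubicPairing v w‖ ≤ 3 * M ^ 2 * (r * ‖fn w‖ ^ 2) := by
  have hdiff : ∀ᵐ x ∂volume.restrict D, fn u x - fn v x = r * fn w x := by
    have h1 : fn u - fn v = (r : ℂ) • fn w := congrArg (fnL D) hw
    have h2 := Lp.coeFn_sub (fn u) (fn v)
    rw [h1] at h2
    filter_upwards [h2, Lp.coeFn_smul (r : ℂ) (fn w)] with x h3 h4
    rw [← Pi.sub_apply, ← h3, h4, Pi.smul_apply, smul_eq_mul]
  have hw2 : ‖fn w‖ ^ 2 = ∫ x in D, ‖fn w x‖ ^ 2 := by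
    have h := L2.inner_def (𝕜 := ℂ) (fn w) (fn w)
    rw [inner_self_eq_norm_sq_to_K] at h
    simp only [inner_self_eq_norm_sq_to_K] at h
    have h' : ((‖fn w‖ ^ 2 : ℝ) : ℂ) = ∫ x in D, ((‖fn w x‖ ^ 2 : ℝ) : ℂ) := by
      push_cast
      exact h
    rw [integral_complex_ofReal] at h'
    exact_mod_cast h'
  have hint : Integrable (fun x => ‖fn w x‖ ^ 2) (volume.restrict D) :=
    (memLp_two_iff_integrable_sq_norm (Lp.memLp (fn w)).aestronglyMeasurable).1 (Lp.memLp (fn w))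
  rw [cubicPairing, cubicPairing,
    ← integral_sub (integrable_cubicPairing hD hu w) (integrable_cubicPairing hD hv w), hw2,
    ← integral_const_mul, ← integral_const_mul]
  refine norm_integral_le_of_norm_le ((hint.const_mul _).const_mul _) ?_
  filter_upwards [hu, hv, hdiff] with x h1 h2 h3
  rw [← sub_mul, ← map_sub, norm_mul, RCLike.norm_conj]
  calc _ ≤ 3 * M ^ 2 * ‖fn u x - fn v x‖ * ‖fn w x‖ := by
        gcongr; exact norm_cubic_sub_le h1 h2
    _ = _ := by
        rw [h3, norm_mul, Complex.norm_real, Real.norm_eq_abs, abs_of_nonneg hr]; ring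

/-! ### Uniqueness on a single time interval. -/

lemma polyEval_sub {E : Type*} [AddCommGroup E] [Module ℂ E] {m : ℕ} (φ ψ : Fin m → E) (t : ℝ) :
    polyEval (fun j => φ j - ψ j) t = polyEval φ t - polyEval ψ t := by
  simp [polyEval, smul_sub]

lemma contDiff_fn_polyEval {m : ℕ} (φ : Fin m → H1 D) :
    ContDiff ℝ ∞ fun t => fn (polyEval φ t) :=
  ((fnL D).restrictScalars ℝ).contDiff.comp (contDiff_polyEval φ)

/-- The integrand of the fully discrete scheme. -/
noncomputable def schemeIntegrand (Ω β : ℝ) (V : Space d → ℝ) (u v : ℝ → H1 D) (t : ℝ) : ℂ :=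
  inner ℂ (Complex.I • deriv (fun s => fn (u s)) t) (fn (v t)) - hForm Ω V (u t) (v t)
    - (β : ℂ) * cubicPairing (u t) (v t)

lemma intervalIntegrable_schemeIntegrand (hD : IsConvexPolyhedralDomain D) (Ω β : ℝ)
    {V : Space d → ℝ} (hV : MemLp V ∞ (volume.restrict D)) {m n : ℕ} (φ : Fin m → H1 D)
    (hφ : ∀ j, φ j ∈ boundedH1 D) (χ : Fin n → H1 D) {a b : ℝ} (ha : 0 ≤ a) (hab : a ≤ b) :
    IntervalIntegrable (schemeIntegrand Ω β V (polyEval φ) (polyEval χ)) volume a b := by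
  refine ContinuousOn.intervalIntegrable ?_
  rw [uIcc_of_le hab]
  have h1 := (contDiff_fn_polyEval φ).continuous_deriv (by simp)
  have h2 := (contDiff_fn_polyEval χ).continuous
  exact ((((h1.const_smul Complex.I).inner h2).sub
    (continuous_hForm_polyEval hD Ω hV φ χ)).continuousOn).sub
    (continuousOn_const.mul (continuousOn_cubicPairing hD φ hφ χ ha))

/-- The coefficients of a polynomial that is bounded for almost all times are bounded. -/
lemma coeff_mem_boundedH1 {m : ℕ} (φ : Fin m → H1 D) {a b M : ℝ} (hab : a < b)
    (h : ∀ᵐ t ∂volume.restrict (Ioc a b), ∀ᵐ x ∂volume.restrict D, ‖fn (polyEval φ t) x‖ ≤ M)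
    (j : Fin m) : φ j ∈ boundedH1 D := by
  -- The set of times at which the bound holds is infinite: a finite set is null, while `(a, b]` has
  -- positive measure.
  refine coeff_mem_of_infinite _ φ
    (s := {t | ∀ᵐ x ∂volume.restrict D, ‖fn (polyEval φ t) x‖ ≤ M}) (fun hfin => ?_)
    (fun t ht => memLp_top_of_bound (Lp.memLp (fn (polyEval φ t))).aestronglyMeasurable M ht) j
  have h1 : ∀ᵐ t ∂volume.restrict (Ioc a b), False := by
    filter_upwards [h, ae_restrict_of_ae (hfin.countable.ae_notMem volume)] with t h2 h3
    exact h3 h2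
  rw [eventually_false_iff_eq_bot, ae_eq_bot, Measure.restrict_eq_zero, Real.volume_Ioc,
    ENNReal.ofReal_eq_zero] at h1
  linarith

/-- One step of the scheme is determined by its initial value. -/
lemma polyEval_eq_of_scheme (hD : IsConvexPolyhedralDomain D) (Ω : ℝ) {β : ℝ} (hβ : 0 ≤ β)
    {V : Space d → ℝ} (hV : MemLp V ∞ (volume.restrict D)) (S : Submodule ℂ (H1 D)) {m : ℕ}
    {φ₁ φ₂ : Fin (m + 1) → H1 D} (hφ₁ : ∀ j, φ₁ j ∈ S) (hφ₂ : ∀ j, φ₂ j ∈ S) {a b M : ℝ}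
    (ha : 0 ≤ a) (hab : a < b) (hM : 6 * β * M ^ 2 * (b - a) < 1)
    (hinit : polyEval φ₁ a = polyEval φ₂ a)
    (hb₁ : ∀ᵐ t ∂volume.restrict (Ioc a b), ∀ᵐ x ∂volume.restrict D, ‖fn (polyEval φ₁ t) x‖ ≤ M)
    (hb₂ : ∀ᵐ t ∂volume.restrict (Ioc a b), ∀ᵐ x ∂volume.restrict D, ‖fn (polyEval φ₂ t) x‖ ≤ M)
    (h₁ : ∀ χ : Fin m → H1 D, (∀ j, χ j ∈ S) →
      ∫ t in a..b, schemeIntegrand Ω β V (polyEval φ₁) (polyEval χ) t = 0)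
    (h₂ : ∀ χ : Fin m → H1 D, (∀ j, χ j ∈ S) →
      ∫ t in a..b, schemeIntegrand Ω β V (polyEval φ₂) (polyEval χ) t = 0) :
    ∀ t ∈ Icc a b, polyEval φ₁ t = polyEval φ₂ t := by
  -- Dividing by `t - a` lowers the degree by one, exactly to the degree allowed for test functions.
  obtain ⟨χ, hχS, hχ⟩ := exists_polyEval_eq_sub_smul S (fun j => φ₁ j - φ₂ j)
    (fun j => S.sub_mem (hφ₁ j) (hφ₂ j)) a (by rw [polyEval_sub, hinit, sub_self])
  simp only [polyEval_sub] at hχ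
  have hB₁ := coeff_mem_boundedH1 φ₁ hab hb₁
  have hB₂ := coeff_mem_boundedH1 φ₂ hab hb₂
  have hd (φ : Fin (m + 1) → H1 D) (t : ℝ) : DifferentiableAt ℝ (fun s => fn (polyEval φ s)) t :=
    (contDiff_fn_polyEval φ).differentiable (by simp) t
  let P : ℝ → L2 D := fun t => fn (polyEval χ t)
  have hP : ∀ t, HasDerivAt P (deriv P t) t := fun t =>
    ((contDiff_fn_polyEval χ).differentiable (by simp) t).hasDerivAt
  have hderiv : ∀ t, deriv (fun s => fn (polyEval φ₁ s)) t - deriv (fun s => fn (polyEval φ₂ s)) t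
      = P t + ((t - a : ℝ) : ℂ) • deriv P t := by
    intro t
    have e : (fun s => fn (polyEval φ₁ s) - fn (polyEval φ₂ s)) = fun s => (s - a) • P s := by
      funext s
      have := congrArg (fnL D) (hχ s)
      rw [map_sub, map_smul] at this
      exact this.trans (Complex.coe_smul _ _)
    have h3 : HasDerivAt (fun s => (s - a) • P s) ((t - a) • deriv P t + (1 : ℝ) • P t) t :=
      ((hasDerivAt_id t).sub_const a).smul (hP t)
    rw [← e] at h3
    rw [((hd φ₁ t).hasDerivAt.sub (hd φ₂ t).hasDerivAt).unique h3, add_comm, one_smul,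
      Complex.coe_smul]
    rfl
  let c : ℝ → ℝ := fun t => β * (cubicPairing (polyEval φ₁ t) (polyEval χ t)
    - cubicPairing (polyEval φ₂ t) (polyEval χ t)).im
  have hc : ContinuousOn c (Icc a b) :=
    continuousOn_const.mul (Complex.continuous_im.comp_continuousOn
      ((continuousOn_cubicPairing hD φ₁ hB₁ χ ha).sub (continuousOn_cubicPairing hD φ₂ hB₂ χ ha)))
  -- The inner product is conjugate-linear in its first slot, so the factor `i` comes out as `-i`
  -- and the imaginary part becomes minus a real part.
  have him : ∀ t, (schemeIntegrand Ω β V (polyEval φ₁) (polyEval χ) t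
      - schemeIntegrand Ω β V (polyEval φ₂) (polyEval χ) t).im =
      -((inner ℂ (P t + ((t - a : ℝ) : ℂ) • deriv P t) (P t)).re + c t) := by
    intro t
    have e1 : schemeIntegrand Ω β V (polyEval φ₁) (polyEval χ) t
        - schemeIntegrand Ω β V (polyEval φ₂) (polyEval χ) t =
        inner ℂ (Complex.I • (P t + ((t - a : ℝ) : ℂ) • deriv P t)) (P t)
        - hForm Ω V (((t - a : ℝ) : ℂ) • polyEval χ t) (polyEval χ t)
        - (β : ℂ) * (cubicPairing (polyEval φ₁ t) (polyEval χ t)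
          - cubicPairing (polyEval φ₂ t) (polyEval χ t)) := by
      rw [← hderiv, ← hχ, ← hForm_sub_left hD Ω hV, smul_sub, inner_sub_left]
      simp only [schemeIntegrand, P]
      ring
    rw [e1, Complex.sub_im, Complex.sub_im, hForm_ofReal_smul_self_im, inner_smul_left,
      Complex.im_ofReal_mul, Complex.conj_I]
    simp only [neg_mul, Complex.neg_im, Complex.I_mul_im, c]
    ring
  have hzero : ∫ t in a..b, ((inner ℂ (P t + ((t - a : ℝ) : ℂ) • deriv P t) (P t)).re + c t)
      = 0 := by
    have hi₁ := intervalIntegrable_schemeIntegrand hD Ω β hV φ₁ hB₁ χ ha hab.le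
    have hi₂ := intervalIntegrable_schemeIntegrand hD Ω β hV φ₂ hB₂ χ ha hab.le
    have h3 := Complex.imCLM.intervalIntegral_comp_comm (hi₁.sub hi₂)
    rw [intervalIntegral.integral_sub hi₁ hi₂, h₁ χ hχS, h₂ χ hχS, sub_zero, map_zero] at h3
    simp only [Complex.imCLM_apply, him, intervalIntegral.integral_neg] at h3
    exact neg_eq_zero.1 h3
  -- Here `K = 3 β M²`, so the smallness condition `2 K (b - a) < 1` is `hM`.
  have hP0 := eq_zero_of_integral_inner_deriv hP
    ((contDiff_fn_polyEval χ).continuous_deriv (by simp)) hab (K := 3 * β * M ^ 2) (by positivity)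
    (by linarith) hc (by
      filter_upwards [hb₁, hb₂, ae_restrict_mem measurableSet_Ioc] with t h3 h4 h5
      have h6 := (Complex.abs_im_le_norm _).trans
        (norm_cubicPairing_sub_le hD (sub_nonneg.2 h5.1.le) h3 h4 (hχ t))
      rw [abs_mul, abs_of_nonneg hβ]
      calc _ ≤ β * (3 * M ^ 2 * ((t - a) * ‖P t‖ ^ 2)) := by gcongr
        _ = _ := by ring) hzero
  intro t ht
  -- The energy argument sees only the `L²` component; injectivity of `fn` recovers the weak
  -- gradient as well.
  have h3 : polyEval χ t = 0 := fn_injective hD (hP0 t ht)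
  rw [← sub_eq_zero, hχ, h3, smul_zero]

/-! ### From single intervals to the whole partition. -/

lemma ae_norm_le_of_linftyNorm_le {T M : ℝ} (hM : 0 ≤ M) {u : ℝ → H1 D}
    (h : linftyNorm T u ≤ ENNReal.ofReal M) {a b : ℝ} (ha : 0 ≤ a) (hb : b ≤ T) :
    ∀ᵐ t ∂volume.restrict (Ioc a b), ∀ᵐ x ∂volume.restrict D, ‖fn (u t) x‖ ≤ M := by
  -- The essential supremum is over `[0, T)`, which misses the endpoint when `b = T`; that point is
  -- null.
  rw [← restrict_Ioo_eq_restrict_Ioc]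
  refine ae_restrict_of_ae_restrict_of_subset (t := Ico 0 T)
    (fun t ht => ⟨ha.trans ht.1.le, ht.2.trans_le hb⟩) ?_
  have h1 := ENNReal.ae_le_essSup (μ := volume.restrict (Ico 0 T))
    fun t => eLpNorm (fn (u t)) ∞ (volume.restrict D)
  filter_upwards [h1] with t ht
  have h2 := ht.trans h
  rw [eLpNorm_exponent_top] at h2
  filter_upwards [ae_le_eLpNormEssSup (f := fn (u t)) (μ := volume.restrict D)] with x hx
  have h3 := hx.trans h2
  rwa [← ofReal_norm, ENNReal.ofReal_le_ofReal_iff hM] at h3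

lemma TimePartition.step_le_maxStep {T : ℝ} (π : TimePartition T) (n : Fin π.N) :
    π.step n ≤ π.maxStep :=
  le_ciSup (Set.finite_range _).bddAbove n

/-- A time in `(0, T]` belongs to one of the intervals of the partition. -/
lemma TimePartition.exists_mem_Ioc {T : ℝ} (π : TimePartition T) {t : ℝ} (ht : t ∈ Ioc 0 T) :
    ∃ n : Fin π.N, t ∈ Ioc (π.t n.castSucc) (π.t n.succ) := by
  by_contra! hne
  have h : ∀ k : Fin (π.N + 1), π.t k < t := by
    intro k
    induction k using Fin.induction with
    | zero => rw [π.first]; exact ht.1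
    | succ k ih => exact not_le.1 fun h => hne k ⟨ih, h⟩
  exact absurd ht.2 (not_le.2 (π.last ▸ h (Fin.last π.N)))

lemma TimePartition.mem_unique {T : ℝ} (π : TimePartition T) {t : ℝ} {n k : Fin π.N}
    (hn : t ∈ Ioc (π.t n.castSucc) (π.t n.succ)) (hk : t ∈ Ioc (π.t k.castSucc) (π.t k.succ)) :
    n = k := by
  have key : ∀ {n k : Fin π.N}, t ∈ Ioc (π.t n.castSucc) (π.t n.succ) →
      t ∈ Ioc (π.t k.castSucc) (π.t k.succ) → ¬ n < k := by
    intro n k hn hk hlt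
    have h1 : π.t n.succ ≤ π.t k.castSucc := π.strictMono.monotone hlt
    exact absurd (hk.1.trans_le (hn.2.trans h1)) (lt_irrefl _)
  exact le_antisymm (not_lt.1 (key hk hn)) (not_lt.1 (key hn hk))

/-- On an interval of the partition, a fully discrete solution coincides with a polynomial
satisfying the variational equation on this interval. -/
lemma IsDiscreteSolution.exists_polyEval {T Ω β : ℝ} {V : Space d → ℝ} {S : Submodule ℂ (H1 D)}
    {π : TimePartition T} {m : ℕ} {u₀ : H1 D} {u : ℝ → H1 D}
    (h : IsDiscreteSolution Ω β V S π (m + 1) u₀ u) (n : Fin π.N) :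
    ∃ φ : Fin (m + 2) → H1 D, (∀ j, φ j ∈ S) ∧
      (∀ t ∈ Ioc (π.t n.castSucc) (π.t n.succ), u t = polyEval φ t) ∧
      (∀ χ : Fin (m + 1) → H1 D, (∀ j, χ j ∈ S) →
        ∫ t in (π.t n.castSucc)..(π.t n.succ),
          schemeIntegrand Ω β V (polyEval φ) (polyEval χ) t = 0) := by
  classical
  obtain ⟨φ, hφ, hu⟩ := h.mem
  refine ⟨φ n, hφ n, hu n, fun χ hχ => ?_⟩
  have hlt : π.t n.castSucc < π.t n.succ := π.strictMono Fin.castSucc_lt_succ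
  -- Functions in `V_{q-1}` may jump at the nodes, so a local test polynomial can be extended by
  -- zero.
  let v : ℝ → H1 D := fun t =>
    if t ∈ Ioc (π.t n.castSucc) (π.t n.succ) then polyEval χ t else 0
  have hv : MemV S π (m + 1 - 1) v := by
    refine ⟨fun k j => if k = n then χ j else 0, fun k j => ?_, fun k t ht => ?_⟩
    · dsimp only
      split_ifs
      exacts [hχ j, S.zero_mem]
    · by_cases hk : k = n
      · subst hk
        simp only [v, if_pos ht, if_true]
        rfl
      · have : t ∉ Ioc (π.t n.castSucc) (π.t n.succ) := fun h => hk (π.mem_unique ht h)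
        simp only [v, if_neg this, if_neg hk, smul_zero, Finset.sum_const_zero]
  -- The open interval is used because at the right node `u` may pass to another polynomial, and its
  -- derivative there need not be that of `φ n`.
  rw [← h.eqn n v hv, intervalIntegral.integral_of_le hlt.le, intervalIntegral.integral_of_le hlt.le,
    integral_Ioc_eq_integral_Ioo, integral_Ioc_eq_integral_Ioo]
  refine setIntegral_congr_fun measurableSet_Ioo fun t ht => ?_
  have ht' := Ioo_subset_Ioc_self ht
  have hev : (fun s => fn (u s)) =ᶠ[𝓝 t] fun s => fn (polyEval (φ n) s) := by
    filter_upwards [Ioo_mem_nhds ht.1 ht.2] with s hs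
    rw [hu n s (Ioo_subset_Ioc_self hs)]
    rfl
  have hut : u t = polyEval (φ n) t := hu n t ht'
  simp only [schemeIntegrand, v, if_pos ht', hev.deriv_eq, hut]

lemma eqOn_of_isDiscreteSolution (hD : IsConvexPolyhedralDomain D) {T Ω β M : ℝ} (hβ : 0 ≤ β)
    (hM0 : 0 ≤ M) {V : Space d → ℝ} (hV : MemLp V ∞ (volume.restrict D)) {S : Submodule ℂ (H1 D)}
    {π : TimePartition T} (hπ : 6 * β * M ^ 2 * π.maxStep < 1) {q : ℕ} (hq : 1 ≤ q) {u₀ : H1 D}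
    {u₁ u₂ : ℝ → H1 D} (h₁ : IsDiscreteSolution Ω β V S π q u₀ u₁)
    (h₂ : IsDiscreteSolution Ω β V S π q u₀ u₂) (hb₁ : linftyNorm T u₁ ≤ ENNReal.ofReal M)
    (hb₂ : linftyNorm T u₂ ≤ ENNReal.ofReal M) : EqOn u₁ u₂ (Ioc 0 T) := by
  -- Writing `q = m + 1` turns the truncated difference `q - 1` into `m`.
  obtain ⟨m, rfl⟩ := Nat.exists_eq_add_of_le' hq
  -- Agreement at the left node is required only for `n ≠ 0`: the value of `u` at time `0` is
  -- unconstrained, and the first interval starts from the common right limit `P_h u₀`.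
  have hstep : ∀ n : Fin π.N,
      (n.val ≠ 0 → u₁ (π.t n.castSucc) = u₂ (π.t n.castSucc)) →
      EqOn u₁ u₂ (Ioc (π.t n.castSucc) (π.t n.succ)) := by
    intro n hn
    have hlt : π.t n.castSucc < π.t n.succ := π.strictMono Fin.castSucc_lt_succ
    have h0 : 0 ≤ π.t n.castSucc :=
      π.first.symm.trans_le (π.strictMono.monotone (Fin.zero_le _))
    have hT : π.t n.succ ≤ T :=
      (π.strictMono.monotone (Fin.le_last _)).trans_eq π.last
    obtain ⟨φ₁, hS₁, hu₁, he₁⟩ := h₁.exists_polyEval n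
    obtain ⟨φ₂, hS₂, hu₂, he₂⟩ := h₂.exists_polyEval n
    have hlim : ∃ z, Tendsto u₁ (𝓝[>] (π.t n.castSucc)) (𝓝 z) ∧
        Tendsto u₂ (𝓝[>] (π.t n.castSucc)) (𝓝 z) := by
      by_cases hn0 : n.val = 0
      · have h3 : π.t n.castSucc = 0 := by
          rw [← π.first]
          exact congrArg π.t (Fin.ext hn0)
        rw [h3]
        exact ⟨_, h₁.init, h₂.init⟩
      · refine ⟨_, h₁.jump n hn0, ?_⟩
        rw [hn hn0]
        exact h₂.jump n hn0
    obtain ⟨z, hz₁, hz₂⟩ := hlim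
    -- The polynomial is continuous, so its value at the left node is the right limit of the
    -- solution.
    have hval : ∀ {u : ℝ → H1 D} {φ : Fin (m + 2) → H1 D},
        (∀ t ∈ Ioc (π.t n.castSucc) (π.t n.succ), u t = polyEval φ t) →
        Tendsto u (𝓝[>] (π.t n.castSucc)) (𝓝 z) → polyEval φ (π.t n.castSucc) = z := by
      intro u φ hu hz
      refine tendsto_nhds_unique (((contDiff_polyEval φ).continuous.tendsto _).mono_left
        nhdsWithin_le_nhds) (hz.congr' ?_)
      filter_upwards [Ioc_mem_nhdsGT hlt] with t ht using hu t ht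
    have hbd : ∀ {u : ℝ → H1 D} {φ : Fin (m + 2) → H1 D},
        (∀ t ∈ Ioc (π.t n.castSucc) (π.t n.succ), u t = polyEval φ t) →
        linftyNorm T u ≤ ENNReal.ofReal M →
        ∀ᵐ t ∂volume.restrict (Ioc (π.t n.castSucc) (π.t n.succ)),
          ∀ᵐ x ∂volume.restrict D, ‖fn (polyEval φ t) x‖ ≤ M := by
      intro u φ hu hb
      filter_upwards [ae_norm_le_of_linftyNorm_le hM0 hb h0 hT, ae_restrict_mem measurableSet_Ioc]
        with t h3 h4
      rwa [← hu t h4]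
    have hsmall : 6 * β * M ^ 2 * (π.t n.succ - π.t n.castSucc) < 1 :=
      (mul_le_mul_of_nonneg_left (π.step_le_maxStep n) (by positivity)).trans_lt hπ
    intro t ht
    rw [hu₁ t ht, hu₂ t ht]
    exact polyEval_eq_of_scheme hD Ω hβ hV S hS₁ hS₂ h0 hlt hsmall
      ((hval hu₁ hz₁).trans (hval hu₂ hz₂).symm) (hbd hu₁ hb₁) (hbd hu₂ hb₂) he₁ he₂ t
      (Ioc_subset_Icc_self ht)
  have hnode : ∀ k : Fin (π.N + 1), k.val ≠ 0 → u₁ (π.t k) = u₂ (π.t k) := by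
    intro k
    induction k using Fin.induction with
    | zero => exact fun h => absurd rfl h
    | succ k ih =>
      exact fun _ => hstep k ih (right_mem_Ioc.2 (π.strictMono Fin.castSucc_lt_succ))
  intro t ht
  obtain ⟨n, hn⟩ := π.exists_mem_Ioc ht
  exact hstep n (hnode n.castSucc) hn

end GPE
theorem lemma7p3 {d : ℕ} (hd1 : 1 ≤ d) (hd3 : d ≤ 3) (D : Set (GPE.Space d))
    (hD : GPE.IsConvexPolyhedralDomain D) (T : ℝ) (hT : 0 < T)
    (β : ℝ) (hβ : 0 ≤ β)
    (V : GPE.Space d → ℝ) (hV : MemLp V ∞ (volume.restrict D))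
    (hV0 : ∀ᵐ x ∂(volume.restrict D), 0 ≤ V x)
    (Ω : ℝ)
    (hΩ : ∃ lam > (0 : ℝ), ∀ᵐ x ∂(volume.restrict D),
      0 ≤ V x - (1 + lam) / 4 * Ω ^ 2 * GPE.planarSq x)
    (S : ℝ → Submodule ℂ (GPE.H1 D))
    (hS0 : ∀ h : ℝ, 0 < h → ∀ v ∈ S h, v ∈ GPE.H10 D)
    (hSfin : ∀ h : ℝ, 0 < h → FiniteDimensional ℂ (S h))
    (hA5 : GPE.RitzSobolevEstimate Ω V S)
    (hA6 : GPE.InverseEstimate S)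
    (hA7 : GPE.RitzLinftyEstimate Ω V S)
    (ρ : ℝ) (hρ : 0 < ρ) (q : ℕ) (hq : 1 ≤ q)
    (u₀ : GPE.H1 D) (hu₀ : u₀ ∈ GPE.H10 D) :
    (∀ M₀ : ℝ, 0 < M₀ → ∃ τ₀ : ℝ, 0 < τ₀ ∧
      ∀ h : ℝ, 0 < h → ∀ π : GPE.TimePartition T, π.QuasiUniform ρ → π.maxStep < τ₀ →
        ∀ u₁ u₂ : ℝ → GPE.H1 D,
          GPE.IsDiscreteSolution Ω β V (S h) π q u₀ u₁ →
          GPE.IsDiscreteSolution Ω β V (S h) π q u₀ u₂ →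
          GPE.linftyNorm T u₁ ≤ ENNReal.ofReal M₀ →
          GPE.linftyNorm T u₂ ≤ ENNReal.ofReal M₀ →
          Set.EqOn u₁ u₂ (Set.Ioc 0 T)) ∧
    (∀ M : ℝ, 0 < M → ∃ τ₀ : ℝ, 0 < τ₀ ∧
      ∀ τ₁ h₁ : ℝ, 0 < τ₁ → 0 < h₁ → ∀ U W : ℝ → GPE.TimePartition T → ℝ → GPE.H1 D,
        GPE.IsBoundedSolutionFamily Ω β V S ρ q u₀ M τ₁ h₁ U →
        GPE.IsBoundedSolutionFamily Ω β V S ρ q u₀ M τ₁ h₁ W →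
        ∀ h : ℝ, 0 < h → h < h₁ → ∀ π : GPE.TimePartition T, π.QuasiUniform ρ →
          π.maxStep < τ₀ → π.maxStep < τ₁ → Set.EqOn (U h π) (W h π) (Set.Ioc 0 T)) := by
  -- The threshold `1 / (6 β M₀² + 1)` works since `x / (x + 1) < 1` for `x ≥ 0`; the added `1`
  -- covers `β = 0`.
  have key : ∀ M₀ : ℝ, 0 < M₀ → ∀ π : GPE.TimePartition T,
      π.maxStep < 1 / (6 * β * M₀ ^ 2 + 1) → 6 * β * M₀ ^ 2 * π.maxStep < 1 := by
    intro M₀ hM π hπ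
    have h0 : 0 ≤ 6 * β * M₀ ^ 2 := by positivity
    refine (mul_le_mul_of_nonneg_left hπ.le h0).trans_lt ?_
    rw [mul_one_div, div_lt_one (by positivity)]
    linarith
  refine ⟨fun M₀ hM => ⟨1 / (6 * β * M₀ ^ 2 + 1), by positivity, ?_⟩,
    fun M hM => ⟨1 / (6 * β * M ^ 2 + 1), by positivity, ?_⟩⟩
  · intro h _ π _ hτ u₁ u₂ h₁ h₂ hb₁ hb₂
    exact GPE.eqOn_of_isDiscreteSolution hD hβ hM.le hV (key M₀ hM π hτ) hq h₁ h₂ hb₁ hb₂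
  · intro τ₁ h₁ _ _ U W hU hW h hh hh₁ π hπ hτ hτ₁
    obtain ⟨hU1, hU2⟩ := hU h hh hh₁ π hπ hτ₁
    obtain ⟨hW1, hW2⟩ := hW h hh hh₁ π hπ hτ₁
    exact GPE.eqOn_of_isDiscreteSolution hD hβ hM.le hV (key M hM π hτ) hq hU1 hW1 hU2.le hW2.le
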